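/- Let $G$ and $H$ be graphs, with vertex sets $V$ and $W$, whose undirected edges are labeled by $n$ labels and which have distinguished vertices $d_1,\dots,d_h\in V$ and $e_1,\dots,e_h\in W$ respectively; two vertices may be joined by edges with different labels, and $H$ may be infinite. For binary relations $R_1,\dots,R_n$ on a set $A$, let $G(R_1,\dots,R_n)$ be the set of all $(a_1,\dots,a_h)\in A^h$ for which there is a function $c\colon V\to A$ with $c(d_k)=a_k$ for $k=1,\dots,h$ and with $c(v)\mathrel{R_i}c(v')$ whenever $v,v'$ are connected by an edge with the $i$-th label; define $H(R_1,\dots,R_n)$ similarly. Call $G$ regular if $V$ is finite and, for each $i$, every class of the least equivalence relation on $V$ that relates any two vertices connected by an edge with the $i$-th label has at most $2$ elements. For binary relations $\beta,\gamma$ and $m\ge 1$, let $\beta\circ_m\gamma=\beta\circ\gamma\circ\beta\circ\cdots$ with $m$ factors, alternately $\beta$ and $\gamma$. Let $\mathcal V$ be a variety of algebras and suppose that $G$ is regular. Then the following are equivalent. (i) $G(\alpha_1,\dots,\alpha_n)\subseteq H(\alpha_1,\dots,\alpha_n)$ for every algebra $A\in\mathcal V$ and all congruences $\alpha_1,\dots,\alpha_n$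 of $A$. (ii) $G(\beta_1\circ\gamma_1\circ\beta_1,\dots,\beta_n\circ\gamma_n\circ\beta_n)\subseteq H(\beta_1\circ\gamma_1\circ\beta_1,\dots,\beta_n\circ\gamma_n\circ\beta_n)$ for every $A\in\mathcal V$ and all congruences $\beta_1,\gamma_1,\dots,\beta_n,\gamma_n$ of $A$. (iii) For every odd $m\ge 1$, $G(\beta_1\circ_m\gamma_1,\dots,\beta_n\circ_m\gamma_n)\subseteq H(\beta_1\circ_m\gamma_1,\dots,\beta_n\circ_m\gamma_n)$ for every $A\in\mathcal V$ and all congruences $\beta_1,\gamma_1,\dots,\beta_n,\gamma_n$ of $A$. (iv) For some odd $m\ge 1$, the inclusion in (iii) holds for every $A\in\mathcal V$ and all congruences $\beta_1,\gamma_1,\dots,\beta_n,\gamma_n$ of $A$. -/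

import Mathlib

universe u v w

namespace GraphInclusion

open FirstOrder

/-- A graph with vertex set `V`, with (undirected) edges labeled by `n` labels and with `h`
distinguished vertices. Two vertices may be connected by edges with several different labels. -/
structure LabeledGraph (V : Type*) (n h : ℕ) where
  /-- `adj i v w`: the vertices `v` and `w` are connected by an edge with the `i`-th label. -/
  adj : Fin n → V → V → Prop
  adj_symm : ∀ i v w, adj i v w → adj i w v
  /-- The distinguished vertices. -/
  dist : Fin h → V

namespace LabeledGraph

variable {V W : Type*} {n h : ℕ}

/-- The least equivalence relation on the vertices relating any two vertices which are
connected by an edge with the `i`-th label. -/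
def sim (G : LabeledGraph V n h) (i : Fin n) : V → V → Prop :=
  Relation.EqvGen (G.adj i)

/-- A graph is regular if it is finite and, for every label, all the equivalence classes of the
associated equivalence relation have at most two elements. -/
def IsRegular (G : LabeledGraph V n h) : Prop :=
  Finite V ∧ ∀ (i : Fin n) (x : V), {y : V | G.sim i x y}.encard ≤ 2

/-- The `h`-ary relation `G(R₁, …, Rₙ)` on `A`: the tuples that can be connected by `G`. -/
def rel {A : Type*} (G : LabeledGraph V n h) (R : Fin n → A → A → Prop) (a : Fin h → A) : Prop :=
  ∃ c : V → A, (∀ k, a k = c (G.dist k)) ∧ ∀ i x y, G.adj i x y → R i (c x) (c y)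

/-- The inclusion `G(R₁, …, Rₙ) ⊆ H(R₁, …, Rₙ)`. -/
def Incl {A : Type*} (G : LabeledGraph V n h) (H : LabeledGraph W n h)
    (R : Fin n → A → A → Prop) : Prop :=
  ∀ a : Fin h → A, G.rel R a → H.rel R a

end LabeledGraph

/-- `A` belongs to the variety defined by the set `E` of identities (pairs of terms). -/
def InVariety {L : FirstOrder.Language.{u, v}} (E : Set (L.Term ℕ × L.Term ℕ))
    (A : Type*) [L.Structure A] : Prop :=
  ∀ e ∈ E, ∀ x : ℕ → A, e.1.realize x = e.2.realize x

/-- A congruence of the algebra `A`: an equivalence relation compatible with all operations. -/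
structure IsCongruence (L : FirstOrder.Language.{u, v}) {A : Type*} [L.Structure A]
    (r : A → A → Prop) : Prop where
  equivalence : Equivalence r
  compatible : ∀ {k : ℕ} (f : L.Functions k) (x y : Fin k → A), (∀ j, r (x j) (y j)) →
    r (Language.Structure.funMap f x) (Language.Structure.funMap f y)

/-- `altComp β γ m` is `β ∘ₘ γ`, that is, `β ∘ γ ∘ β ∘ ⋯` with `m` factors. -/
def altComp {A : Type*} (β γ : A → A → Prop) : ℕ → A → A → Prop
  | 0 => Eq
  | m + 1 => Relation.Comp β (altComp γ β m)

end GraphInclusion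

namespace GraphInclusion

open FirstOrder

/-! For odd `m`, `β ∘ₘ γ` has the form `R ∘ R⁻¹` with `R` reflexive and compatible (`altComp_odd`).
Let `c` map `G` into `A` along the relations `Rᵢ ∘ Rᵢ⁻¹`. Since the classes of `G` have at most two
elements, each class for label `i` has a common `Rᵢ`-successor `bᵢ` (`IsRegular.exists_common`). The
tuples `(c, b₁, …, bₙ)` lie in a subalgebra of `Aⁿ⁺¹`, where the kernels of the last `n` projections
are congruences connecting them. The congruence inclusion applies there, and first coordinates give
the required map from `H` (`incl_of_congruence_incl`). Conversely, `β = γ = α` recovers congruences.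
-/

/-- A relation preserved by all operations of the algebra `A`. -/
def IsCompatible (L : FirstOrder.Language.{u, v}) {A : Type*} [L.Structure A]
    (r : A → A → Prop) : Prop :=
  ∀ {k : ℕ} (f : L.Functions k) (x y : Fin k → A), (∀ j, r (x j) (y j)) →
    r (Language.Structure.funMap f x) (Language.Structure.funMap f y)

section AltComp

variable {A : Type*} {β γ : A → A → Prop}

theorem altComp_refl (hβ : ∀ x, β x x) (hγ : ∀ x, γ x x) (m : ℕ) (x : A) :
    altComp β γ m x x := by
  induction m generalizing β γ with
  | zero => rfl
  | succ m ih => exact ⟨x, hβ x, ih hγ hβ⟩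

theorem altComp_compatible {L : FirstOrder.Language.{u, v}} [L.Structure A]
    (hβ : IsCompatible L β) (hγ : IsCompatible L γ) (m : ℕ) :
    IsCompatible L (altComp β γ m) := by
  induction m generalizing β γ with
  | zero =>
    intro k f x y h
    exact congrArg _ (funext h)
  | succ m ih =>
    intro k f x y h
    choose z hxz hzy using h
    exact ⟨_, hβ f x z hxz, ih hγ hβ f z y hzy⟩

theorem altComp_self (hβ : Equivalence β) (m : ℕ) : altComp β β (m + 1) = β := by
  induction m with
  | zero => exact Relation.comp_eq
  | succ m ih =>
    rw [altComp, ih]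
    funext x y
    exact propext ⟨fun ⟨_, h₁, h₂⟩ => hβ.trans h₁ h₂, fun h => ⟨x, hβ.refl x, h⟩⟩

theorem altComp_three :
    altComp β γ 3 = Relation.Comp β (Relation.Comp γ β) := by
  simp only [altComp, Relation.comp_eq]

/-- The recursion adds factors on the left; this adds one on the right, so that `altComp_odd` can
strip both ends at once. -/
theorem altComp_odd_succ (β γ : A → A → Prop) (k : ℕ) :
    altComp β γ (2 * k + 2) = Relation.Comp (altComp β γ (2 * k + 1)) γ := by
  induction k with
  | zero => simp only [altComp, Relation.comp_eq]
  | succ k ih =>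
    change Relation.Comp β (Relation.Comp γ (altComp β γ (2 * k + 2))) =
      Relation.Comp (Relation.Comp β (Relation.Comp γ (altComp β γ (2 * k + 1)))) γ
    rw [ih, Relation.comp_assoc, Relation.comp_assoc]

/-- With an odd number of factors, `β ∘ₘ γ` is a relation composed with its own converse. -/
theorem altComp_odd (hβ : Equivalence β) (hγ : Equivalence γ) (k : ℕ) (x y : A) :
    altComp β γ (2 * k + 1) x y ↔
      ∃ z, altComp β γ (k + 1) x z ∧ altComp β γ (k + 1) y z := by
  induction k generalizing β γ x y with
  | zero =>
    simp only [altComp, Relation.comp_eq]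
    exact ⟨fun h => ⟨y, h, hβ.refl y⟩, fun ⟨_, h₁, h₂⟩ => hβ.trans h₁ (hβ.symm h₂)⟩
  | succ k ih =>
    change Relation.Comp β (altComp γ β (2 * k + 2)) x y ↔ _
    rw [altComp_odd_succ]
    constructor
    · rintro ⟨s, hxs, t, hst, hty⟩
      obtain ⟨z, hsz, htz⟩ := (ih hγ hβ s t).1 hst
      exact ⟨z, ⟨s, hxs, hsz⟩, ⟨t, hβ.symm hty, htz⟩⟩
    · rintro ⟨z, ⟨s, hxs, hsz⟩, ⟨t, hyt, htz⟩⟩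
      exact ⟨s, hxs, t, (ih hγ hβ s t).2 ⟨z, hsz, htz⟩, hβ.symm hyt⟩

end AltComp

namespace LabeledGraph

variable {V W : Type*} {n h : ℕ} {G : LabeledGraph V n h}

theorem eq_of_sim_of_isolated {i : Fin n} {v : V} (hv : ∀ z, G.adj i v z → z = v) {y : V}
    (hy : G.sim i v y) : y = v := by
  have key : ∀ a b, Relation.EqvGen (G.adj i) a b → (a = v ↔ b = v) := by
    intro a b hab
    induction hab with
    | rel a b hab =>
      constructor
      · rintro rfl
        exact hv b hab
      · rintro rfl
        exact hv a (G.adj_symm i a b hab)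
    | refl a => rfl
    | symm a b _ ih => exact ih.symm
    | trans a b c _ _ ih₁ ih₂ => exact ih₁.trans ih₂
  exact (key v y hy).1 rfl

theorem IsRegular.eq_or_eq_of_sim (hG : G.IsRegular) {i : Fin n} {v z : V} (hvz : G.adj i v z)
    (hne : z ≠ v) {y : V} (hy : G.sim i v y) : y = v ∨ y = z := by
  by_contra! hcon
  have hsub : ({v, z, y} : Set V) ⊆ {y : V | G.sim i v y} := by
    rintro a (rfl | rfl | rfl)
    · exact Relation.EqvGen.refl _
    · exact Relation.EqvGen.rel _ _ hvz
    · exact hy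
  have hcard : ({v, z, y} : Set V).encard = 3 :=
    Set.encard_eq_three.2 ⟨v, z, y, hne.symm, hcon.1.symm, hcon.2.symm, rfl⟩
  have := (Set.encard_le_encard hsub).trans (hG.2 i v)
  rw [hcard] at this
  exact absurd this (by decide)

/-- In a regular graph, the vertices of a class can be joined to a common element. -/
theorem IsRegular.exists_common (hG : G.IsRegular) {A : Type*} {R : A → A → Prop}
    (hR : ∀ x, R x x) (i : Fin n) (c : V → A)
    (hc : ∀ x y, G.adj i x y → ∃ z, R (c x) z ∧ R (c y) z) :
    ∃ b : V → A, (∀ x, R (c x) (b x)) ∧ ∀ x y, G.adj i x y → b x = b y := by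
  -- Choosing one element per class makes `b` constant along edges. A class is a singleton, where
  -- reflexivity suffices, or the two ends of an edge, where `hc` gives the element.
  have hex : ∀ q : Quot (G.adj i), ∃ b, ∀ y, Quot.mk _ y = q → R (c y) b := by
    rintro ⟨v⟩
    by_cases hv : ∀ z, G.adj i v z → z = v
    · refine ⟨c v, fun y hy => ?_⟩
      rw [eq_of_sim_of_isolated hv (Quot.eqvGen_exact hy.symm)]
      exact hR _
    · push Not at hv
      obtain ⟨z, hvz, hne⟩ := hv
      obtain ⟨b, hvb, hzb⟩ := hc v z hvz
      refine ⟨b, fun y hy => ?_⟩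
      rcases hG.eq_or_eq_of_sim hvz hne (Quot.eqvGen_exact hy.symm) with rfl | rfl
      · exact hvb
      · exact hzb
  choose g hg using hex
  exact ⟨fun x => g (Quot.mk _ x), fun x => hg _ x rfl,
    fun x y hxy => congrArg g (Quot.sound hxy)⟩

end LabeledGraph

section Product

variable {L : FirstOrder.Language.{u, v}} {A : Type*} {n : ℕ}

/-- The elements `(x, y₁, …, yₙ)` of `Aⁿ⁺¹` with `x Rᵢ yᵢ` for all `i`. -/
def RelatedTuples (R : Fin n → A → A → Prop) : Type _ :=
  {p : A × (Fin n → A) // ∀ i, R i p.1 (p.2 i)}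

variable [L.Structure A] {R : Fin n → A → A → Prop}

/-- Tuples related by compatible relations form a subalgebra of `Aⁿ⁺¹`. -/
@[reducible] def relatedTuplesStructure (hR : ∀ i, IsCompatible L (R i)) :
    L.Structure (RelatedTuples R) where
  funMap f x := ⟨(Language.Structure.funMap f fun j => (x j).1.1,
    fun i => Language.Structure.funMap f fun j => (x j).1.2 i),
    fun i => hR i f _ _ fun j => (x j).2 i⟩
  -- Immaterial: terms and congruences involve only function symbols.
  RelMap _ _ := False

theorem realize_comp_of_map_fun {B : Type*} [L.Structure B] (p : B → A)
    (hp : ∀ {k : ℕ} (f : L.Functions k) (x : Fin k → B),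
      p (Language.Structure.funMap f x) = Language.Structure.funMap f fun j => p (x j))
    {ι : Type*} (t : L.Term ι) (x : ι → B) :
    p (t.realize x) = t.realize fun j => p (x j) := by
  induction t with
  | var => rfl
  | func f ts ih =>
    simp only [Language.Term.realize, hp, ih]

theorem relatedTuples_inVariety {E : Set (L.Term ℕ × L.Term ℕ)} (hA : InVariety E A)
    (hR : ∀ i, IsCompatible L (R i)) :
    letI := relatedTuplesStructure hR
    InVariety E (RelatedTuples R) := by
  let := relatedTuplesStructure hR
  intro e he x
  refine Subtype.ext (Prod.ext ?_ (funext fun i => ?_))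
  · have hp := fun t : L.Term ℕ =>
      realize_comp_of_map_fun (fun q : RelatedTuples R => q.1.1) (fun _ _ => rfl) t x
    exact (hp e.1).trans ((hA e he _).trans (hp e.2).symm)
  · have hp := fun t : L.Term ℕ =>
      realize_comp_of_map_fun (fun q : RelatedTuples R => q.1.2 i) (fun _ _ => rfl) t x
    exact (hp e.1).trans ((hA e he _).trans (hp e.2).symm)

/-- These are projection kernels; related tuples have first coordinates in `Rᵢ ∘ Rᵢ⁻¹`, with the
shared coordinate as witness. -/
theorem relatedTuples_isCongruence (hR : ∀ i, IsCompatible L (R i)) (i : Fin n) :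
    letI := relatedTuplesStructure hR
    IsCongruence L fun p q : RelatedTuples R => p.1.2 i = q.1.2 i := by
  let := relatedTuplesStructure hR
  exact
    { equivalence := ⟨fun _ => rfl, Eq.symm, Eq.trans⟩
      compatible := fun f _ _ hxy => congrArg (Language.Structure.funMap f) (funext hxy) }

end Product

/-- If `G` is regular, an inclusion between congruences valid throughout a variety extends to
the relations `Rᵢ ∘ Rᵢ⁻¹`, for `Rᵢ` reflexive and compatible. -/
theorem incl_of_congruence_incl {L : FirstOrder.Language.{u, v}} {E : Set (L.Term ℕ × L.Term ℕ)}
    {n h : ℕ} {V W : Type*} {G : LabeledGraph V n h} {H : LabeledGraph W n h}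
    (hG : G.IsRegular)
    (hincl : ∀ (A : Type w) [L.Structure A] [Nonempty A], InVariety E A →
      ∀ α : Fin n → A → A → Prop, (∀ i, IsCongruence L (α i)) → G.Incl H α)
    {A : Type w} [L.Structure A] [Nonempty A] (hA : InVariety E A)
    {R : Fin n → A → A → Prop} (hrefl : ∀ i x, R i x x) (hR : ∀ i, IsCompatible L (R i)) :
    G.Incl H fun i x y => ∃ z, R i x z ∧ R i y z := by
  rintro a ⟨c, hac, hc⟩
  choose b hcb hb using fun i => hG.exists_common (hrefl i) i c (hc i)
  let := relatedTuplesStructure hR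
  have : Nonempty (RelatedTuples R) :=
    ‹Nonempty A›.map fun x => ⟨(x, fun _ => x), fun i => hrefl i x⟩
  let x : V → RelatedTuples R := fun v => ⟨(c v, fun i => b i v), fun i => hcb i v⟩
  obtain ⟨d, had, hd⟩ := hincl (RelatedTuples R) (relatedTuples_inVariety hA hR) _
    (relatedTuples_isCongruence hR) (fun k => x (G.dist k))
    ⟨x, fun _ => rfl, fun i v v' hvv' => hb i v v' hvv'⟩
  refine ⟨fun t => (d t).1.1, fun k => (hac k).trans (congrArg (fun q => q.1.1) (had k)),
    fun i s t hst => ⟨(d s).1.2 i, (d s).2 i, ?_⟩⟩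
  have heq : (d s).1.2 i = (d t).1.2 i := hd i s t hst
  rw [heq]
  exact (d t).2 i

end GraphInclusion

open GraphInclusion FirstOrder in
theorem corollary4 {L : FirstOrder.Language.{u, v}} [L.IsAlgebraic] (E : Set (L.Term ℕ × L.Term ℕ))
    {n h : ℕ} {V : Type*} {W : Type*} (G : LabeledGraph V n h) (H : LabeledGraph W n h)
    (hG : G.IsRegular) :
    List.TFAE [
      -- (i)
      ∀ (A : Type (max u w)) [L.Structure A] [Nonempty A], InVariety E A →
        ∀ α : Fin n → A → A → Prop, (∀ i, IsCongruence L (α i)) →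
          G.Incl H α,
      -- (ii)
      ∀ (A : Type (max u w)) [L.Structure A] [Nonempty A], InVariety E A →
        ∀ β γ : Fin n → A → A → Prop, (∀ i, IsCongruence L (β i)) → (∀ i, IsCongruence L (γ i)) →
          G.Incl H (fun i => Relation.Comp (β i) (Relation.Comp (γ i) (β i))),
      -- (iii), for every odd m
      ∀ m : ℕ, Odd m →
        ∀ (A : Type (max u w)) [L.Structure A] [Nonempty A], InVariety E A →
        ∀ β γ : Fin n → A → A → Prop, (∀ i, IsCongruence L (β i)) → (∀ i, IsCongruence L (γ i)) →
          G.Incl H (fun i => altComp (β i) (γ i) m),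
      -- (iii), for some odd m
      ∃ m : ℕ, Odd m ∧
        ∀ (A : Type (max u w)) [L.Structure A] [Nonempty A], InVariety E A →
        ∀ β γ : Fin n → A → A → Prop, (∀ i, IsCongruence L (β i)) → (∀ i, IsCongruence L (γ i)) →
          G.Incl H (fun i => altComp (β i) (γ i) m)] := by

  tfae_have 1 → 3 := by
    rintro hi m ⟨k, rfl⟩ A _ _ hA β γ hβ hγ
    have heq : (fun i => altComp (β i) (γ i) (2 * k + 1)) = fun i x y =>
        ∃ z, altComp (β i) (γ i) (k + 1) x z ∧ altComp (β i) (γ i) (k + 1) y z := by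
      funext i x y
      exact propext (altComp_odd (hβ i).equivalence (hγ i).equivalence k x y)
    rw [heq]
    exact incl_of_congruence_incl hG hi hA
      (fun i => altComp_refl (hβ i).equivalence.refl (hγ i).equivalence.refl _)
      (fun i => altComp_compatible (hβ i).compatible (hγ i).compatible _)
  tfae_have 3 → 2 := by
    intro hiii A _ _ hA β γ hβ hγ
    simpa only [altComp_three] using hiii 3 (by decide) A hA β γ hβ hγ
  tfae_have 2 → 4 := by
    intro hii
    refine ⟨3, by decide, fun A _ _ hA β γ hβ hγ => ?_⟩
    simpa only [altComp_three] using hii A hA β γ hβ hγ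
  tfae_have 4 → 1 := by
    rintro ⟨m, ⟨k, rfl⟩, hiv⟩ A _ _ hA α hα
    -- By transitivity and reflexivity, `α ∘ₘ α = α` for `m ≥ 1`.
    have hincl := hiv A hA α α hα hα
    simpa only [altComp_self (hα _).equivalence] using hincl
  tfae_finish
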